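/- Let $n\ge 1$ and let $\mathbb H^n$ be the Poincaré ball: the open unit ball $D^n=\{p\in\mathbb R^n : |p|<1\}$ with the Riemannian metric $H_p=\left(\frac{2}{1-|p|^2}\right)^2 I_n$. Write $\|v\|=\sqrt{v^\top H_p v}$ for $v\in T_p\mathbb H^n=\mathbb R^n$, let $d$ be the Riemannian distance (the infimum of the lengths of curves), $\exp_p$ the exponential map, and $(\operatorname{grad} f)_p=H_p^{-1}(\partial_1 f,\dots,\partial_n f)^\top$. For $S\subset\mathbb H^n$, a function $f:\mathbb H^n\to\mathbb R$ that is differentiable at the points of $S$ is called geodesically $\mu$-strongly convex on $S$ if $$f(\exp_p(v))-f(p)-v^\top H_p(\operatorname{grad} f)_p\ \ge\ \tfrac{\mu}{2}\|v\|^2\qquad\text{for all } p\in S,\ v\in T_p\mathbb H^n,$$ and geodesically $L$-smooth on $S$ if $$\left|f(\exp_p(v))-f(p)-v^\top H_p(\operatorname{grad} f)_p\right|\ \le\ \tfrac{L}{2}\|v\|^2\qquad\text{for all } p\in S,\ v\in T_p\mathbb H^n.$$ Let $K\subset\mathbb H^n$ be a compact set that contains the origin, and let $f(p)=\tfrac12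 d(0,p)^2$. Read $\theta\coth\theta$ as $1$ at $\theta=0$. Then: 1. $f$ is geodesically $1$-strongly convex on $\mathbb H^n$ (in particular on $K$). 2. The maximum $L=\max_{p\in K} d(0,p)\coth d(0,p)$ exists, and $f$ is geodesically $L$-smooth on $K$. 3. $f$ is twice differentiable on $\mathbb H^n$, and at every $p\in\mathbb H^n$, with $\theta=d(0,p)$, the Riemannian Hessian operator $H_p^{-1}\left(\partial_i\partial_j f-\sum_k\Gamma_{ij}^k\,\partial_k f\right)_{i,j}$ of $f$ at $p$, where $\Gamma_{ij}^k$ are the Christoffel symbols of the metric, has characteristic polynomial $(X-1)(X-\theta\coth\theta)^{n-1}$; that is, its eigenvalues are $1$ (with multiplicity $1$) and $\theta\coth\theta$ (with multiplicity $n-1$). -/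

import Mathlib

open scoped Matrix

noncomputable section

namespace PoincareBall

/-- The open unit disk of `ℝⁿ`, the underlying set of the Poincaré model. -/
def disk (n : ℕ) : Set (EuclideanSpace ℝ (Fin n)) := Metric.ball 0 1

/-- The metric matrix `H_p = (2 / (1 - |p|²))² I`. -/
def metricMatrix {n : ℕ} (p : EuclideanSpace ℝ (Fin n)) : Matrix (Fin n) (Fin n) ℝ :=
  (2 / (1 - ‖p‖ ^ 2)) ^ 2 • (1 : Matrix (Fin n) (Fin n) ℝ)

/-- The inner product `vᵀ H_p w` of two tangent vectors at `p`. -/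
def metricInner {n : ℕ} (p v w : EuclideanSpace ℝ (Fin n)) : ℝ :=
  v.ofLp ⬝ᵥ (metricMatrix p *ᵥ w.ofLp)

/-- The magnitude `‖v‖ = √(vᵀ H_p v)` of a tangent vector at `p`. -/
def metricNorm {n : ℕ} (p v : EuclideanSpace ℝ (Fin n)) : ℝ :=
  √(metricInner p v v)

/-- A continuously differentiable curve in the disk from `p` to `q`, parametrized by `[0, 1]`. -/
structure IsCurveFromTo {n : ℕ} (γ : ℝ → EuclideanSpace ℝ (Fin n))
    (p q : EuclideanSpace ℝ (Fin n)) : Prop where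
  contDiffOn : ContDiffOn ℝ 1 γ (Set.Icc 0 1)
  mem_disk : ∀ t ∈ Set.Icc (0 : ℝ) 1, γ t ∈ disk n
  source : γ 0 = p
  target : γ 1 = q

/-- The Riemannian length of a curve parametrized by `[0, 1]`. -/
def curveLength {n : ℕ} (γ : ℝ → EuclideanSpace ℝ (Fin n)) : ℝ :=
  ∫ t in (0 : ℝ)..1, metricNorm (γ t) (derivWithin γ (Set.Icc 0 1) t)

/-- The hyperbolic distance: the infimum of the lengths of the curves from `p` to `q`. -/
def hypDist {n : ℕ} (p q : EuclideanSpace ℝ (Fin n)) : ℝ :=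
  sInf {l | ∃ γ : ℝ → EuclideanSpace ℝ (Fin n), IsCurveFromTo γ p q ∧ l = curveLength γ}

/-- The Christoffel symbols `Γ_{ij}^k` of the metric at `p`; that is, `0` if `i, j, k` are pairwise
distinct, and otherwise `2 / (1 - |p|²)` times `-p^k` if `i = j ≠ k`, `p^k` if `i = j = k`,
`p^j` if `i = k ≠ j`, and `p^i` if `j = k ≠ i`. -/
def christoffel {n : ℕ} (i j k : Fin n) (p : EuclideanSpace ℝ (Fin n)) : ℝ :=
  2 / (1 - ‖p‖ ^ 2) *
    ((if i = k then p j else 0) + (if j = k then p i else 0) - (if i = j then p k else 0))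

/-- A (complete, affinely parametrized) geodesic of the disk: a solution `γ : ℝ → D` of
`(γ^k)'' + ∑_{i,j} Γ_{ij}^k(γ) (γ^i)' (γ^j)' = 0` for all `k`. -/
structure IsGeodesic {n : ℕ} (γ : ℝ → EuclideanSpace ℝ (Fin n)) : Prop where
  contDiff : ContDiff ℝ 2 γ
  mem_disk : ∀ t, γ t ∈ disk n
  equation : ∀ (t : ℝ) (k : Fin n),
    deriv (deriv γ) t k
      + ∑ i, ∑ j, christoffel i j k (γ t) * deriv γ t i * deriv γ t j = 0

open Classical in
/-- The exponential map `exp_p(v) = γ_v(1)`, where `γ_v` is the geodesic with `γ_v(0) = p` and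
`γ_v'(0) = v`. (For `p` in the disk there is exactly one such geodesic; the second branch is only
relevant for `p` outside of the disk.) -/
def expMap {n : ℕ} (p v : EuclideanSpace ℝ (Fin n)) : EuclideanSpace ℝ (Fin n) :=
  if h : ∃ γ : ℝ → EuclideanSpace ℝ (Fin n), IsGeodesic γ ∧ γ 0 = p ∧ deriv γ 0 = v
  then h.choose 1 else p

/-- The partial derivative `∂f/∂p^i` at `p`. -/
def partialDeriv {n : ℕ} (f : EuclideanSpace ℝ (Fin n) → ℝ) (i : Fin n)
    (p : EuclideanSpace ℝ (Fin n)) : ℝ :=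
  fderiv ℝ f p (EuclideanSpace.single i 1)

/-- The Riemannian gradient `(grad f)_p = H_p⁻¹ (∂₁f, …, ∂ₙf)ᵀ`. -/
def grad {n : ℕ} (f : EuclideanSpace ℝ (Fin n) → ℝ) (p : EuclideanSpace ℝ (Fin n)) :
    EuclideanSpace ℝ (Fin n) :=
  WithLp.toLp 2 ((metricMatrix p)⁻¹ *ᵥ fun i => partialDeriv f i p)

/-- The Riemannian Hessian of `f` at `p`, with entries `∂ᵢ∂ⱼf - ∑ₖ Γ_{ij}^k ∂ₖf`. -/
def hessian {n : ℕ} (f : EuclideanSpace ℝ (Fin n) → ℝ) (p : EuclideanSpace ℝ (Fin n)) :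
    Matrix (Fin n) (Fin n) ℝ :=
  Matrix.of fun i j =>
    partialDeriv (partialDeriv f j) i p - ∑ k, christoffel i j k p * partialDeriv f k p

/-- The Riemannian Hessian of `f` at `p` as an operator on tangent vectors: the matrix
`H_p⁻¹ (Hess f)(p)`. -/
def hessianOperator {n : ℕ} (f : EuclideanSpace ℝ (Fin n) → ℝ) (p : EuclideanSpace ℝ (Fin n)) :
    Matrix (Fin n) (Fin n) ℝ :=
  (metricMatrix p)⁻¹ * hessian f p

/-- `f` is geodesically `μ`-strongly convex at the points of `S`:
`f(exp_p(v)) - f(p) - vᵀ H_p (grad f)_p ≥ (μ/2) ‖v‖²` for all `p ∈ S` and all tangent vectors `v`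
at `p`. -/
def GeodesicallyStronglyConvexOn {n : ℕ} (μ : ℝ) (f : EuclideanSpace ℝ (Fin n) → ℝ)
    (S : Set (EuclideanSpace ℝ (Fin n))) : Prop :=
  ∀ p ∈ S, DifferentiableAt ℝ f p ∧ ∀ v : EuclideanSpace ℝ (Fin n),
    μ / 2 * metricNorm p v ^ 2 ≤ f (expMap p v) - f p - metricInner p v (grad f p)

/-- `f` is geodesically `L`-smooth at the points of `S`:
`|f(exp_p(v)) - f(p) - vᵀ H_p (grad f)_p| ≤ (L/2) ‖v‖²` for all `p ∈ S` and all tangent vectors `v`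
at `p`. -/
def GeodesicallySmoothOn {n : ℕ} (L : ℝ) (f : EuclideanSpace ℝ (Fin n) → ℝ)
    (S : Set (EuclideanSpace ℝ (Fin n))) : Prop :=
  ∀ p ∈ S, DifferentiableAt ℝ f p ∧ ∀ v : EuclideanSpace ℝ (Fin n),
    |f (expMap p v) - f p - metricInner p v (grad f p)| ≤ L / 2 * metricNorm p v ^ 2

/-- The function `θ ↦ θ coth θ`, with its limit value `1` at `θ = 0`. -/
def mulCoth (θ : ℝ) : ℝ :=
  if θ = 0 then 1 else θ * (Real.cosh θ / Real.sinh θ)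

/-- Half the squared hyperbolic distance from the origin. -/
def halfSqDist (n : ℕ) (p : EuclideanSpace ℝ (Fin n)) : ℝ :=
  1 / 2 * hypDist 0 p ^ 2

end PoincareBall

end

noncomputable section

namespace PoincareBall

open Real

/-! Put `c = d(0,p)`, `b = ‖v‖`, `a = d(0, exp_p v)`, and let `y` be the cosine of the Euclidean
angle between `p` and `v`. The metric is conformal, so the triangle `0, p, exp_p v` has angle cosine
`-y` at `p`, and the hyperbolic law of cosines reads `cosh a = cosh b cosh c + sinh b sinh c · y`
(`cosh_hypDist_zero_expMap`). The gradient term equals `b c y`, so convexity and smoothness together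
become `b² ≤ a² - c² - 2bcy ≤ (c coth c) b²` (`law_of_cosines_comparison`).

For the two bounds, compare `cosh a` with `cosh √(ζb² + c² + 2bcy)` as functions of `b`, with `ζ =
1` and `ζ = c coth c`. The former solves `u'' = u`; the latter has the same value and slope at `b =
0` and is a sub- or supersolution. The case `ζ = c coth c` rests on the monotonicity of `tanh x / x`
and `(x - tanh x) / x³`.

The law of cosines itself comes from `d(0,p) = 2 artanh |p|`: along a geodesic of speed `b`, `cosh
d(0,γ) = (1+|γ|²)/(1-|γ|²)` satisfies `u'' = b² u`. Geodesics exist for all time because they are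
projections of explicit curves on the hyperboloid.

For the Hessian, `f` is radial, so its Hessian operator is a scalar matrix plus a rank-one matrix
along `p`; its spectrum can then be read off (`hessianOperator_halfSqDist`). -/

/-! ### Elementary inequalities for hyperbolic functions. -/

theorem self_le_sinh_mul_cosh {x : ℝ} (hx : 0 ≤ x) : x ≤ sinh x * cosh x := by
  nlinarith [self_le_sinh_iff.2 hx, one_le_cosh x]

theorem sinh_lt_self_mul_cosh {x : ℝ} (hx : 0 < x) : sinh x < x * cosh x := by
  have hm : StrictMonoOn (fun x : ℝ => x * cosh x - sinh x) (Set.Ici 0) := by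
    have hd : ∀ x : ℝ, HasDerivAt (fun x : ℝ => x * cosh x - sinh x) (x * sinh x) x := fun x =>
      (((hasDerivAt_id x).mul (hasDerivAt_cosh x)).sub (hasDerivAt_sinh x)).congr_deriv (by simp)
    refine strictMonoOn_of_deriv_pos (convex_Ici 0) (by fun_prop) fun x hx => ?_
    rw [(hd x).deriv]
    have : 0 < x := by simpa using hx
    exact mul_pos this (sinh_pos_iff.2 this)
  have := hm (Set.mem_Ici.2 le_rfl) (Set.mem_Ici.2 hx.le) hx
  simp at this
  linarith

theorem sinh_le_self_mul_cosh {x : ℝ} (hx : 0 ≤ x) : sinh x ≤ x * cosh x := by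
  rcases hx.eq_or_lt with rfl | hx
  · simp
  · exact (sinh_lt_self_mul_cosh hx).le

/-- `θ ↦ tanh θ / θ` is decreasing. -/
theorem antitoneOn_sinh_div_mul_cosh :
    AntitoneOn (fun x : ℝ => sinh x / (x * cosh x)) (Set.Ioi 0) := by
  have hd : ∀ x : ℝ, 0 < x → HasDerivAt (fun x : ℝ => sinh x / (x * cosh x))
      ((x - sinh x * cosh x) / (x * cosh x) ^ 2) x := fun x hx => by
    have hc := cosh_pos x
    refine ((hasDerivAt_sinh x).div ((hasDerivAt_id x).mul (hasDerivAt_cosh x))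
      (by simp; constructor <;> positivity)).congr_deriv ?_
    have := cosh_sq x
    simp only [id, Pi.mul_apply]
    congr 1
    linear_combination x * this
  refine antitoneOn_of_deriv_nonpos (convex_Ioi 0)
    (fun x hx => (hd x hx).continuousAt.continuousWithinAt)
    (fun x hx => (hd x (by simpa using hx)).differentiableAt.differentiableWithinAt)
    fun x hx => ?_
  have hx : 0 < x := by simpa using hx
  rw [(hd x hx).deriv]
  exact div_nonpos_of_nonpos_of_nonneg (by linarith [self_le_sinh_mul_cosh hx.le]) (sq_nonneg _)

/-- The difference of the two sides vanishes at `0` and has derivative `4 sinh x (x cosh x - sinh x)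
≥ 0`. It is the sign of the numerator in the derivative of `(x - tanh x) / x³`. -/
theorem three_mul_sinh_mul_cosh_le {x : ℝ} (hx : 0 ≤ x) :
    3 * sinh x * cosh x ≤ x * (2 * cosh x ^ 2 + 1) := by
  have hm : MonotoneOn (fun x : ℝ => x * (2 * cosh x ^ 2 + 1) - 3 * sinh x * cosh x)
      (Set.Ici 0) := by
    have hd : ∀ x : ℝ, HasDerivAt
        (fun x : ℝ => x * (2 * cosh x ^ 2 + 1) - 3 * sinh x * cosh x)
        (4 * sinh x * (x * cosh x - sinh x)) x := fun x => by
      refine (((hasDerivAt_id x).mul ((((hasDerivAt_cosh x).pow 2).const_mul 2).add_const 1)).sub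
        (((hasDerivAt_sinh x).const_mul 3).mul (hasDerivAt_cosh x))).congr_deriv ?_
      have := cosh_sq x
      simp
      linear_combination (-1) * this
    refine monotoneOn_of_deriv_nonneg (convex_Ici 0) (by fun_prop) (by fun_prop) fun x hx => ?_
    rw [(hd x).deriv]
    have : 0 < x := by simpa using hx
    exact mul_nonneg (by linarith [sinh_nonneg_iff.2 this.le])
      (by linarith [sinh_le_self_mul_cosh this.le])
  have := hm (Set.mem_Ici.2 le_rfl) (Set.mem_Ici.2 hx) hx
  simp at this
  linarith

/-- `θ ↦ (θ - tanh θ) / θ³` is decreasing. -/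
theorem antitoneOn_sub_tanh_div_cube :
    AntitoneOn (fun x : ℝ => (x - sinh x / cosh x) / x ^ 3) (Set.Ioi 0) := by
  have hd : ∀ x : ℝ, 0 < x → HasDerivAt (fun x : ℝ => (x - sinh x / cosh x) / x ^ 3)
      ((3 * sinh x * cosh x - x * (2 * cosh x ^ 2 + 1)) / (x ^ 4 * cosh x ^ 2)) x := fun x hx => by
    have hc := cosh_pos x
    refine (((hasDerivAt_id x).sub ((hasDerivAt_sinh x).div (hasDerivAt_cosh x) hc.ne')).div
      ((hasDerivAt_id x).pow 3) (by simp; positivity)).congr_deriv ?_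
    have := cosh_sq x
    simp only [id, Pi.sub_apply, Pi.div_apply, Pi.pow_apply]
    field_simp
    push_cast
    rw [show sinh x ^ 2 = cosh x ^ 2 - 1 by linarith]
    ring
  refine antitoneOn_of_deriv_nonpos (convex_Ioi 0)
    (fun x hx => (hd x hx).continuousAt.continuousWithinAt)
    (fun x hx => (hd x (by simpa using hx)).differentiableAt.differentiableWithinAt)
    fun x hx => ?_
  have hx : 0 < x := by simpa using hx
  rw [(hd x hx).deriv]
  exact div_nonpos_of_nonpos_of_nonneg (by linarith [three_mul_sinh_mul_cosh_le hx.le])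
    (by positivity)

/-! ### Comparison of hyperbolic triangles with quadratic expressions. -/

/-- Factor `φ'' - φ = (D + 1)(D - 1)φ`: first `eᵗ(φ' - φ)` is increasing from `0`, then `e⁻ᵗφ` is.
-/
theorem nonneg_of_le_second_deriv {φ φ₁ φ₂ : ℝ → ℝ} (h₁ : ∀ t, HasDerivAt φ (φ₁ t) t)
    (h₂ : ∀ t, HasDerivAt φ₁ (φ₂ t) t) (h : ∀ t, φ t ≤ φ₂ t) (h0 : φ 0 = 0) (h0' : φ₁ 0 = 0)
    {t : ℝ} (ht : 0 ≤ t) : 0 ≤ φ t := by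
  have hm₁ : Monotone fun t => exp t * (φ₁ t - φ t) := by
    have hd : ∀ t, HasDerivAt (fun t => exp t * (φ₁ t - φ t)) (exp t * (φ₂ t - φ t)) t := fun t =>
      ((hasDerivAt_exp t).mul ((h₂ t).sub (h₁ t))).congr_deriv (by simp; ring)
    refine monotone_of_deriv_nonneg (fun t => (hd t).differentiableAt) fun t => ?_
    rw [(hd t).deriv]
    exact mul_nonneg (exp_pos t).le (by linarith [h t])
  have hle : ∀ t, 0 ≤ t → φ t ≤ φ₁ t := fun t ht => by
    have := hm₁ ht
    simp only [h0, h0', sub_self, mul_zero] at this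
    linarith [nonneg_of_mul_nonneg_right this (exp_pos t)]
  have hm₂ : MonotoneOn (fun t => exp (-t) * φ t) (Set.Ici 0) := by
    have hd : ∀ t, HasDerivAt (fun t => exp (-t) * φ t) (exp (-t) * (φ₁ t - φ t)) t := fun t =>
      ((hasDerivAt_neg t).exp.mul (h₁ t)).congr_deriv (by ring)
    refine monotoneOn_of_deriv_nonneg (convex_Ici 0)
      (fun t _ => (hd t).continuousAt.continuousWithinAt)
      (fun t _ => (hd t).differentiableAt.differentiableWithinAt) fun t ht => ?_
    rw [(hd t).deriv]
    have ht : 0 < t := by simpa using ht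
    exact mul_nonneg (exp_pos _).le (by linarith [hle t ht.le])
  have := hm₂ (Set.mem_Ici.2 le_rfl) (Set.mem_Ici.2 ht) ht
  simp only [h0, mul_zero] at this
  exact nonneg_of_mul_nonneg_right this (exp_pos _)

section Comparison

variable {ζ c y : ℝ}

/-- Strict positivity of the quadratic keeps the square root differentiable. The coefficient `ζ`
stays free because the upper comparison takes `c coth c` and the lower one takes `1`. -/
theorem hasDerivAt_cosh_sqrt_quadratic (hR : ∀ t, 0 < ζ * t ^ 2 + c ^ 2 + 2 * t * c * y) (t : ℝ) :
    HasDerivAt (fun t => cosh √(ζ * t ^ 2 + c ^ 2 + 2 * t * c * y))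
      (sinh √(ζ * t ^ 2 + c ^ 2 + 2 * t * c * y) / √(ζ * t ^ 2 + c ^ 2 + 2 * t * c * y)
        * (ζ * t + c * y)) t := by
  have hd : HasDerivAt (fun t => ζ * t ^ 2 + c ^ 2 + 2 * t * c * y) (2 * (ζ * t + c * y)) t := by
    refine (((((hasDerivAt_id t).pow 2).const_mul ζ).add_const (c ^ 2)).add
      ((((hasDerivAt_id t).const_mul 2).mul_const c).mul_const y)).congr_deriv ?_
    simp; ring
  refine ((hd.sqrt (hR t).ne').cosh).congr_deriv ?_
  field_simp

theorem hasDerivAt_deriv_cosh_sqrt_quadratic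
    (hR : ∀ t, 0 < ζ * t ^ 2 + c ^ 2 + 2 * t * c * y) (t : ℝ) :
    HasDerivAt (fun t => sinh √(ζ * t ^ 2 + c ^ 2 + 2 * t * c * y)
        / √(ζ * t ^ 2 + c ^ 2 + 2 * t * c * y) * (ζ * t + c * y))
      (ζ * (sinh √(ζ * t ^ 2 + c ^ 2 + 2 * t * c * y) / √(ζ * t ^ 2 + c ^ 2 + 2 * t * c * y))
        + (ζ * t + c * y) ^ 2 / (ζ * t ^ 2 + c ^ 2 + 2 * t * c * y)
          * (cosh √(ζ * t ^ 2 + c ^ 2 + 2 * t * c * y)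
            - sinh √(ζ * t ^ 2 + c ^ 2 + 2 * t * c * y)
              / √(ζ * t ^ 2 + c ^ 2 + 2 * t * c * y))) t := by
  have hd : HasDerivAt (fun t => ζ * t ^ 2 + c ^ 2 + 2 * t * c * y) (2 * (ζ * t + c * y)) t := by
    refine (((((hasDerivAt_id t).pow 2).const_mul ζ).add_const (c ^ 2)).add
      ((((hasDerivAt_id t).const_mul 2).mul_const c).mul_const y)).congr_deriv ?_
    simp; ring
  have hs := hd.sqrt (hR t).ne'
  have hw := sqrt_pos.2 (hR t)
  refine ((hs.sinh.div hs hw.ne').mul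
    (((hasDerivAt_id t).const_mul ζ).add_const (c * y))).congr_deriv ?_
  have hsq := sq_sqrt (hR t).le
  simp only [id, Pi.div_apply]
  generalize hw' : √(ζ * t ^ 2 + c ^ 2 + 2 * t * c * y) = w at *
  rw [← hsq]
  field_simp
  ring

/-- The upper comparison for hyperbolic triangles with two given sides `b` and `c`, and the cosine
`-y` of the angle between them. -/
theorem cosh_le_cosh_sqrt (hc : 0 < c) (hy : |y| ≤ 1) (hζ : ζ = c * (cosh c / sinh c)) {b : ℝ}
    (hb : 0 ≤ b) :
    cosh b * cosh c + sinh b * sinh c * y ≤ cosh √(ζ * b ^ 2 + c ^ 2 + 2 * b * c * y) := by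
  have hy2 : y ^ 2 ≤ 1 := by rw [← sq_abs]; nlinarith [abs_nonneg y]
  have hsc := sinh_pos_iff.2 hc
  have hζ1 : 1 < ζ := by
    rw [hζ, ← mul_div_assoc, one_lt_div hsc]
    exact sinh_lt_self_mul_cosh hc
  -- Completing the square; as `ζ > 1 ≥ y²`, the quadratic never vanishes.
  have hm : ∀ t, ζ * (ζ * t ^ 2 + c ^ 2 + 2 * t * c * y)
      = (ζ * t + c * y) ^ 2 + c ^ 2 * (ζ - y ^ 2) := fun t => by ring
  have hm0 : 0 < c ^ 2 * (ζ - y ^ 2) := by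
    have : 0 < ζ - y ^ 2 := by linarith
    positivity
  have hR : ∀ t, 0 < ζ * t ^ 2 + c ^ 2 + 2 * t * c * y := fun t => by
    have : 0 < ζ * (ζ * t ^ 2 + c ^ 2 + 2 * t * c * y) := by rw [hm]; positivity
    exact pos_of_mul_pos_right this (by linarith)
  suffices h : 0 ≤ cosh √(ζ * b ^ 2 + c ^ 2 + 2 * b * c * y)
      - (cosh b * cosh c + sinh b * (sinh c * y)) by linarith
  refine nonneg_of_le_second_deriv (φ := fun b => cosh √(ζ * b ^ 2 + c ^ 2 + 2 * b * c * y)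
      - (cosh b * cosh c + sinh b * (sinh c * y)))
    (fun t => (hasDerivAt_cosh_sqrt_quadratic hR t).sub
      (((hasDerivAt_cosh t).mul_const _).add ((hasDerivAt_sinh t).mul_const _)))
    (fun t => (hasDerivAt_deriv_cosh_sqrt_quadratic hR t).sub
      (((hasDerivAt_sinh t).mul_const _).add ((hasDerivAt_cosh t).mul_const _)))
    (fun t => ?_) ?_ ?_ hb
  · simp only [sub_le_sub_iff_right]
    have hw := sqrt_pos.2 (hR t)
    have hsq := sq_sqrt (hR t).le
    have hmt := hm t
    rw [← hsq] at hmt ⊢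
    generalize √(ζ * t ^ 2 + c ^ 2 + 2 * t * c * y) = w at *
    rw [sqrt_sq hw.le]
    have hcw := cosh_pos w
    have hcc := cosh_pos c
    -- With `w` the square root, this is the inequality `g ≤ g''` for `g = cosh w`, divided by `cosh
    -- w` and multiplied by `w²`. By the choice of `ζ` it is sharp at `w = c`, `y = 0`, where `1 -
    -- tanh c / c = (ζ - 1) / ζ`.
    have key : c ^ 2 * (ζ - y ^ 2) * (1 - sinh w / (w * cosh w)) ≤ (ζ - 1) * w ^ 2 := by
      have hnn : 0 ≤ 1 - sinh w / (w * cosh w) := by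
        rw [sub_nonneg, div_le_one (by positivity)]
        exact sinh_le_self_mul_cosh hw.le
      have hcz : 1 - sinh c / (c * cosh c) = (ζ - 1) / ζ := by
        rw [hζ]; field_simp
      -- For `w ≤ c`, bound `c²(ζ - y²)` by `ζw²` and use that `tanh x / x` decreases; for `w ≥ c`,
      -- bound it by `c²ζ` and use that `(x - tanh x) / x³` decreases.
      rcases le_total w c with h | h
      · have h1 := antitoneOn_sinh_div_mul_cosh (Set.mem_Ioi.2 hw) (Set.mem_Ioi.2 hc) h
        simp only at h1
        calc c ^ 2 * (ζ - y ^ 2) * (1 - sinh w / (w * cosh w))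
            ≤ ζ * w ^ 2 * (1 - sinh w / (w * cosh w)) :=
              mul_le_mul_of_nonneg_right (by rw [hmt]; nlinarith [sq_nonneg (ζ * t + c * y)]) hnn
          _ ≤ ζ * w ^ 2 * ((ζ - 1) / ζ) := by
              refine mul_le_mul_of_nonneg_left ?_ (by positivity)
              rw [← hcz]; linarith
          _ = (ζ - 1) * w ^ 2 := by field_simp
      · have h1 := antitoneOn_sub_tanh_div_cube (Set.mem_Ioi.2 hc) (Set.mem_Ioi.2 hw) h
        simp only at h1
        have e : ∀ x : ℝ, 0 < x → (x - sinh x / cosh x) / x ^ 3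
            = (1 - sinh x / (x * cosh x)) / x ^ 2 := fun x hx => by
          have := cosh_pos x
          field_simp
        rw [e w hw, e c hc, hcz] at h1
        calc c ^ 2 * (ζ - y ^ 2) * (1 - sinh w / (w * cosh w))
            ≤ c ^ 2 * ζ * (1 - sinh w / (w * cosh w)) :=
              mul_le_mul_of_nonneg_right
                (mul_le_mul_of_nonneg_left (by linarith [sq_nonneg y]) (sq_nonneg c)) hnn
          _ = c ^ 2 * ζ * w ^ 2 * ((1 - sinh w / (w * cosh w)) / w ^ 2) := by field_simp
          _ ≤ c ^ 2 * ζ * w ^ 2 * ((ζ - 1) / ζ / c ^ 2) :=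
              mul_le_mul_of_nonneg_left h1 (by positivity)
          _ = (ζ - 1) * w ^ 2 := by field_simp
    have hq : (ζ * t + c * y) ^ 2 / w ^ 2 = ζ - c ^ 2 * (ζ - y ^ 2) / w ^ 2 := by
      rw [eq_sub_iff_add_eq, ← add_div, ← hmt]; field_simp
    rw [hq]
    have : c ^ 2 * (ζ - y ^ 2) / w ^ 2 * (1 - sinh w / (w * cosh w)) ≤ ζ - 1 := by
      rw [div_mul_eq_mul_div, div_le_iff₀ (by positivity)]; exact key
    have h2 := mul_le_mul_of_nonneg_right this hcw.le
    have h3 : (1 - sinh w / (w * cosh w)) * cosh w = cosh w - sinh w / w := by field_simp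
    rw [mul_assoc, h3] at h2
    linarith
  · simp [sqrt_sq hc.le]
  · simp [sqrt_sq hc.le]; field_simp; simp

/-- The lower comparison for hyperbolic triangles: the distance between the endpoints of two sides
of given lengths and angle is larger than in the Euclidean plane. -/
theorem cosh_sqrt_le_cosh (hc : 0 < c) (hy : |y| ≤ 1) {b : ℝ} (hb : 0 ≤ b) :
    cosh √(b ^ 2 + c ^ 2 + 2 * b * c * y) ≤ cosh b * cosh c + sinh b * sinh c * y := by
  -- For `y = ±1` the quadratic is a square that may vanish, so the ODE argument is unavailable;
  -- equality then holds by the addition formulas.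
  rcases hy.lt_or_eq with hy | hy
  swap
  · rcases (abs_eq zero_le_one).1 hy with rfl | rfl
    · rw [show b ^ 2 + c ^ 2 + 2 * b * c * 1 = (b + c) ^ 2 by ring, sqrt_sq_eq_abs, cosh_abs,
        cosh_add]
      simp
    · rw [show b ^ 2 + c ^ 2 + 2 * b * c * -1 = (b - c) ^ 2 by ring, sqrt_sq_eq_abs, cosh_abs,
        cosh_sub]
      simp [sub_eq_add_neg]
  have hy2 : y ^ 2 < 1 := by rw [← sq_abs]; nlinarith [abs_nonneg y]
  have hm0 : 0 < c ^ 2 * (1 - y ^ 2) := by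
    have : 0 < 1 - y ^ 2 := by linarith
    positivity
  have hm : ∀ t, 1 * t ^ 2 + c ^ 2 + 2 * t * c * y
      = (1 * t + c * y) ^ 2 + c ^ 2 * (1 - y ^ 2) := fun t => by ring
  have hR : ∀ t, 0 < 1 * t ^ 2 + c ^ 2 + 2 * t * c * y := fun t => by
    rw [hm]; positivity
  suffices h : 0 ≤ cosh b * cosh c + sinh b * (sinh c * y)
      - cosh √(1 * b ^ 2 + c ^ 2 + 2 * b * c * y) by rw [one_mul] at h; linarith
  refine nonneg_of_le_second_deriv (φ := fun b => cosh b * cosh c + sinh b * (sinh c * y)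
      - cosh √(1 * b ^ 2 + c ^ 2 + 2 * b * c * y))
    (fun t => (((hasDerivAt_cosh t).mul_const _).add ((hasDerivAt_sinh t).mul_const _)).sub
      (hasDerivAt_cosh_sqrt_quadratic hR t))
    (fun t => (((hasDerivAt_sinh t).mul_const _).add ((hasDerivAt_cosh t).mul_const _)).sub
      (hasDerivAt_deriv_cosh_sqrt_quadratic hR t))
    (fun t => ?_) ?_ ?_ hb
  · simp only [sub_le_sub_iff_left]
    have hw := sqrt_pos.2 (hR t)
    have hsq := sq_sqrt (hR t).le
    have hmt := hm t
    rw [← hsq] at hmt ⊢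
    generalize √(1 * t ^ 2 + c ^ 2 + 2 * t * c * y) = w at *
    rw [sqrt_sq hw.le]
    have h1 : (1 * t + c * y) ^ 2 / w ^ 2 ≤ 1 := by
      rw [div_le_one (by positivity)]; linarith
    have h2 : sinh w / w ≤ cosh w := by
      rw [div_le_iff₀ hw, mul_comm]; exact sinh_le_self_mul_cosh hw.le
    linarith [mul_le_mul_of_nonneg_right h1 (sub_nonneg.2 h2)]
  · simp [sqrt_sq hc.le]
  · simp [sqrt_sq hc.le]; field_simp; simp

end Comparison

theorem mulCoth_of_pos {c : ℝ} (hc : 0 < c) : mulCoth c = c * (cosh c / sinh c) := by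
  simp [mulCoth, hc.ne']

/-- Comparison of the third side `a` of a hyperbolic triangle with the Euclidean law of cosines,
from above and from below. -/
theorem law_of_cosines_comparison {a b c y : ℝ} (ha : 0 ≤ a) (hb : 0 ≤ b) (hc : 0 ≤ c)
    (hy : |y| ≤ 1) (h : cosh a = cosh b * cosh c + sinh b * sinh c * y) :
    b ^ 2 + c ^ 2 + 2 * b * c * y ≤ a ^ 2 ∧
      a ^ 2 ≤ mulCoth c * b ^ 2 + c ^ 2 + 2 * b * c * y := by
  rcases hc.eq_or_lt with rfl | hc
  · have : a = b := by
      simp only [cosh_zero, sinh_zero, mul_one, mul_zero, zero_mul, add_zero] at h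
      rwa [← cosh_abs a, ← cosh_abs b, cosh_strictMonoOn.eq_iff_eq (Set.mem_Ici.2 (abs_nonneg _))
        (Set.mem_Ici.2 (abs_nonneg _)), abs_of_nonneg ha, abs_of_nonneg hb] at h
    simp [mulCoth, this]
  constructor
  · have h1 := cosh_sqrt_le_cosh hc hy hb
    rw [← h, cosh_le_cosh, abs_of_nonneg (sqrt_nonneg _), abs_of_nonneg ha] at h1
    exact (sqrt_le_left ha).1 h1
  · have h1 := cosh_le_cosh_sqrt hc hy rfl hb
    rw [← mulCoth_of_pos hc, ← h, cosh_le_cosh, abs_of_nonneg (sqrt_nonneg _), abs_of_nonneg ha]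
      at h1
    -- `√R ≥ a` yields `R ≥ a²` only for `a > 0`, since `√` is `0` on negative numbers. For `a = 0`,
    -- `R ≥ (b - c)² ≥ 0` follows from `mulCoth c ≥ 1` and `y ≥ -1`.
    rcases ha.eq_or_lt with rfl | ha
    · have hz : 1 ≤ mulCoth c := by
        rw [mulCoth_of_pos hc, ← mul_div_assoc, one_le_div (sinh_pos_iff.2 hc)]
        exact sinh_le_self_mul_cosh hc.le
      have := (abs_le.1 hy)
      nlinarith [sq_nonneg (b - c), mul_nonneg hb hc.le, sq_nonneg b,
        mul_nonneg (mul_nonneg hb hc.le) (by linarith : 0 ≤ 1 + y)]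
    · exact (le_sqrt' ha).1 h1

/-! ### The metric and the distance from the origin. -/

variable {n : ℕ}

theorem mem_disk_iff {p : EuclideanSpace ℝ (Fin n)} : p ∈ disk n ↔ ‖p‖ < 1 := by
  simp [disk]

theorem one_sub_normSq_pos {p : EuclideanSpace ℝ (Fin n)} (hp : p ∈ disk n) :
    0 < 1 - ‖p‖ ^ 2 := by
  have := mem_disk_iff.1 hp
  nlinarith [norm_nonneg p]

theorem metricInner_eq (p v w : EuclideanSpace ℝ (Fin n)) :
    metricInner p v w = (2 / (1 - ‖p‖ ^ 2)) ^ 2 * inner ℝ v w := by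
  rw [metricInner, metricMatrix, Matrix.smul_mulVec, Matrix.one_mulVec, dotProduct_smul,
    smul_eq_mul, EuclideanSpace.inner_eq_star_dotProduct]
  simp [dotProduct_comm]

theorem metricNorm_eq {p : EuclideanSpace ℝ (Fin n)} (hp : p ∈ disk n)
    (v : EuclideanSpace ℝ (Fin n)) : metricNorm p v = 2 / (1 - ‖p‖ ^ 2) * ‖v‖ := by
  have := one_sub_normSq_pos hp
  rw [metricNorm, metricInner_eq, real_inner_self_eq_norm_sq, ← mul_pow,
    sqrt_sq (by positivity)]

theorem hasDerivAt_artanh {x : ℝ} (hx : x ∈ Set.Ioo (-1 : ℝ) 1) :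
    HasDerivAt artanh (1 / (1 - x ^ 2)) x := by
  have h1 : 0 < 1 + x := by linarith [hx.1]
  have h2 : 0 < 1 - x := by linarith [hx.2]
  have hd : HasDerivAt (fun x : ℝ => 1 / 2 * (log (1 + x) - log (1 - x)))
      (1 / (1 - x ^ 2)) x := by
    refine (((((hasDerivAt_id x).const_add 1).log h1.ne').sub
      (((hasDerivAt_id x).const_sub 1).log h2.ne')).const_mul (1 / 2)).congr_deriv ?_
    have : 1 - x ^ 2 ≠ 0 := by nlinarith
    simp only [id]
    field_simp
    ring
  refine hd.congr_of_eventuallyEq ?_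
  filter_upwards [Ioo_mem_nhds hx.1 hx.2] with z hz
  rw [artanh_eq_half_log ⟨hz.1.le, hz.2.le⟩,
    log_div (by linarith [hz.1]) (by linarith [hz.2])]

/-- The length of a curve from the origin is at least `2 artanh` of the norm of its endpoint. -/
theorem two_mul_artanh_le_curveLength {γ : ℝ → EuclideanSpace ℝ (Fin n)}
    {p : EuclideanSpace ℝ (Fin n)} (hγ : IsCurveFromTo γ 0 p) :
    2 * artanh ‖p‖ ≤ curveLength γ := by
  -- Projecting the curve to the line through its endpoint reduces the length estimate to one
  -- dimension and avoids differentiating the norm at `0`.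
  obtain ⟨e, he, hep⟩ : ∃ e : EuclideanSpace ℝ (Fin n), ‖e‖ ≤ 1 ∧ inner ℝ e p = ‖p‖ := by
    rcases eq_or_ne p 0 with rfl | hp
    · exact ⟨0, by simp, by simp⟩
    · refine ⟨‖p‖⁻¹ • p, by simp [norm_smul, hp], ?_⟩
      rw [real_inner_smul_left, real_inner_self_eq_norm_sq]
      have := norm_ne_zero_iff.2 hp
      field_simp
  set D := derivWithin γ (Set.Icc 0 1) with hD
  have hDc : ContinuousOn D (Set.Icc 0 1) :=
    hγ.contDiffOn.continuousOn_derivWithin (uniqueDiffOn_Icc zero_lt_one) le_rfl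
  have hγc := hγ.contDiffOn.continuousOn
  have hs : ∀ t ∈ Set.Icc (0 : ℝ) 1, inner ℝ e (γ t) ∈ Set.Ioo (-1 : ℝ) 1 ∧
      (inner ℝ e (γ t)) ^ 2 ≤ ‖γ t‖ ^ 2 := fun t ht => by
    have h1 := abs_real_inner_le_norm e (γ t)
    have h2 : |inner ℝ e (γ t)| ≤ ‖γ t‖ := h1.trans
      (mul_le_of_le_one_left (norm_nonneg _) he)
    have h3 := mem_disk_iff.1 (hγ.mem_disk t ht)
    exact ⟨abs_lt.1 (h2.trans_lt h3), by rw [← sq_abs]; gcongr⟩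
  have hcs : ContinuousOn (fun t => inner ℝ e (γ t)) (Set.Icc (0 : ℝ) 1) :=
    continuousOn_const.inner hγc
  have hi1 : ContinuousOn (fun t => 2 * (1 / (1 - (inner ℝ e (γ t)) ^ 2) * inner ℝ e (D t)))
      (Set.Icc (0 : ℝ) 1) := by
    refine continuousOn_const.mul (ContinuousOn.mul (continuousOn_const.div
      (continuousOn_const.sub (hcs.pow 2)) fun t ht => ?_) (continuousOn_const.inner hDc))
    have := one_sub_normSq_pos (hγ.mem_disk t ht)
    linarith [(hs t ht).2]
  have hi2 : ContinuousOn (fun t => metricNorm (γ t) (D t)) (Set.Icc (0 : ℝ) 1) := by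
    have : ContinuousOn (fun t => 2 / (1 - ‖γ t‖ ^ 2) * ‖D t‖) (Set.Icc (0 : ℝ) 1) :=
      ContinuousOn.mul (continuousOn_const.div (continuousOn_const.sub (hγc.norm.pow 2))
        fun t ht => (one_sub_normSq_pos (hγ.mem_disk t ht)).ne') hDc.norm
    exact this.congr fun t ht => metricNorm_eq (hγ.mem_disk t ht) _
  -- The integrand is the derivative of `2 artanh ⟨e, γ⟩`, and it is at most the speed because `⟨e,
  -- γ⟩² ≤ |γ|²` and `⟨e, γ'⟩ ≤ |γ'|`.
  have hftc : ∫ t in (0 : ℝ)..1, 2 * (1 / (1 - (inner ℝ e (γ t)) ^ 2) * inner ℝ e (D t))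
      = 2 * artanh (inner ℝ e (γ 1)) - 2 * artanh (inner ℝ e (γ 0)) := by
    refine intervalIntegral.integral_eq_sub_of_hasDerivAt_of_le
      (f := fun t => 2 * artanh (inner ℝ e (γ t))) zero_le_one
      (fun t ht => ?_) (fun t ht => ?_)
      (hi1.intervalIntegrable_of_Icc zero_le_one)
    · exact ((hasDerivAt_artanh (hs t ht).1).continuousAt.comp_continuousWithinAt
        (f := fun t => inner ℝ e (γ t)) (hcs t ht)).const_smul (2 : ℝ)
    · have ht' := Set.Ioo_subset_Icc_self ht
      have hg : HasDerivAt γ (D t) t :=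
        ((hγ.contDiffOn.differentiableOn one_ne_zero t ht').hasDerivWithinAt).hasDerivAt
          (Icc_mem_nhds ht.1 ht.2)
      have hi : HasDerivAt (fun t => inner ℝ e (γ t)) (inner ℝ e (D t)) t :=
        ((hasDerivAt_const t e).inner ℝ hg).congr_deriv (by simp)
      exact ((hasDerivAt_artanh (hs t ht').1).comp t hi).const_mul 2
  rw [hγ.source, hγ.target, hep] at hftc
  simp only [inner_zero_right, artanh_zero, mul_zero, sub_zero] at hftc
  rw [← hftc, curveLength]
  refine intervalIntegral.integral_mono_on zero_le_one
    (hi1.intervalIntegrable_of_Icc zero_le_one) (hi2.intervalIntegrable_of_Icc zero_le_one)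
    fun t ht => ?_
  have h0 := one_sub_normSq_pos (hγ.mem_disk t ht)
  rw [metricNorm_eq (hγ.mem_disk t ht), ← mul_assoc, mul_one_div]
  have h1 : inner ℝ e (D t) ≤ ‖D t‖ := (real_inner_le_norm _ _).trans
    (mul_le_of_le_one_left (norm_nonneg _) he)
  have h2 := (hs t ht).2
  calc 2 / (1 - (inner ℝ e (γ t)) ^ 2) * inner ℝ e (D t)
      ≤ 2 / (1 - (inner ℝ e (γ t)) ^ 2) * ‖D t‖ := by
        have : 0 < 1 - (inner ℝ e (γ t)) ^ 2 := by linarith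
        gcongr
    _ ≤ _ := by gcongr

/-- The radial segment. -/
theorem exists_curveLength_eq {p : EuclideanSpace ℝ (Fin n)} (hp : p ∈ disk n) :
    ∃ γ : ℝ → EuclideanSpace ℝ (Fin n), IsCurveFromTo γ 0 p ∧
      2 * artanh ‖p‖ = curveLength γ := by
  have hp' := mem_disk_iff.1 hp
  have hlt : ∀ t ∈ Set.Icc (0 : ℝ) 1, t * ‖p‖ < 1 ∧ 0 ≤ t * ‖p‖ := fun t ht =>
    ⟨by nlinarith [norm_nonneg p, ht.1, ht.2], mul_nonneg ht.1 (norm_nonneg p)⟩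
  have hn : ∀ t ∈ Set.Icc (0 : ℝ) 1, ‖t • p‖ = t * ‖p‖ := fun t ht => by
    rw [norm_smul, norm_of_nonneg ht.1]
  have hmem : ∀ t ∈ Set.Icc (0 : ℝ) 1, t • p ∈ disk n := fun t ht =>
    mem_disk_iff.2 (by rw [hn t ht]; exact (hlt t ht).1)
  refine ⟨fun t => t • p, ⟨by fun_prop, hmem, by simp, by simp⟩, ?_⟩
  have hd : ∀ t ∈ Set.Icc (0 : ℝ) 1, derivWithin (fun t : ℝ => t • p) (Set.Icc 0 1) t = p :=
    fun t ht => by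
      have : HasDerivAt (fun t : ℝ => t • p) p t := by
        simpa using (hasDerivAt_id t).smul_const p
      exact this.hasDerivWithinAt.derivWithin (uniqueDiffOn_Icc zero_lt_one t ht)
  have hc : ContinuousOn (fun t : ℝ => 2 * (1 / (1 - (t * ‖p‖) ^ 2) * ‖p‖)) (Set.Icc 0 1) := by
    refine continuousOn_const.mul (ContinuousOn.mul (continuousOn_const.div (by fun_prop)
      fun t ht => ?_) continuousOn_const)
    have := hlt t ht
    nlinarith
  have hae : ∀ t ∈ Set.Icc (0 : ℝ) 1,
      HasDerivAt (fun t => 2 * artanh (t * ‖p‖)) (2 * (1 / (1 - (t * ‖p‖) ^ 2) * ‖p‖)) t :=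
    fun t ht => by
      have := hlt t ht
      have h1 : HasDerivAt (fun t : ℝ => t * ‖p‖) ‖p‖ t := by
        simpa using (hasDerivAt_id t).mul_const ‖p‖
      refine ((hasDerivAt_artanh (x := t * ‖p‖) ⟨by linarith, by linarith⟩).comp t
        h1).const_mul 2 |>.congr_deriv ?_
      simp
  have hftc : ∫ t in (0 : ℝ)..1, 2 * (1 / (1 - (t * ‖p‖) ^ 2) * ‖p‖)
      = 2 * artanh (1 * ‖p‖) - 2 * artanh (0 * ‖p‖) := by
    refine intervalIntegral.integral_eq_sub_of_hasDerivAt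
      (f := fun t => 2 * artanh (t * ‖p‖)) (fun t ht => ?_)
      (hc.intervalIntegrable_of_Icc zero_le_one)
    rw [Set.uIcc_of_le zero_le_one] at ht
    exact hae t ht
  rw [one_mul, zero_mul, artanh_zero, mul_zero, sub_zero] at hftc
  rw [← hftc, curveLength]
  refine intervalIntegral.integral_congr fun t ht => ?_
  rw [Set.uIcc_of_le zero_le_one] at ht
  rw [hd t ht, metricNorm_eq (hmem t ht), hn t ht]
  ring

theorem hypDist_zero_eq {p : EuclideanSpace ℝ (Fin n)} (hp : p ∈ disk n) :
    hypDist 0 p = 2 * artanh ‖p‖ :=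
  IsLeast.csInf_eq ⟨exists_curveLength_eq hp, by
    rintro _ ⟨γ, hγ, rfl⟩
    exact two_mul_artanh_le_curveLength hγ⟩

theorem hypDist_zero_nonneg {p : EuclideanSpace ℝ (Fin n)} (hp : p ∈ disk n) :
    0 ≤ hypDist 0 p := by
  rw [hypDist_zero_eq hp]
  exact mul_nonneg zero_le_two (artanh_nonneg (norm_nonneg p))

theorem cosh_two_mul_artanh {r : ℝ} (hr : r ∈ Set.Ioo (-1 : ℝ) 1) :
    cosh (2 * artanh r) = (1 + r ^ 2) / (1 - r ^ 2) := by
  have h : 0 < 1 - r ^ 2 := by nlinarith [hr.1, hr.2]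
  rw [cosh_two_mul, cosh_artanh hr, sinh_artanh hr, div_pow, div_pow, sq_sqrt h.le]
  field_simp

theorem sinh_two_mul_artanh {r : ℝ} (hr : r ∈ Set.Ioo (-1 : ℝ) 1) :
    sinh (2 * artanh r) = 2 * r / (1 - r ^ 2) := by
  have h : 0 < 1 - r ^ 2 := by nlinarith [hr.1, hr.2]
  have hs := sq_sqrt h.le
  rw [sinh_two_mul, cosh_artanh hr, sinh_artanh hr, ← hs, sqrt_sq (sqrt_nonneg _)]
  field_simp

theorem norm_mem_Ioo {p : EuclideanSpace ℝ (Fin n)} (hp : p ∈ disk n) :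
    ‖p‖ ∈ Set.Ioo (-1 : ℝ) 1 :=
  ⟨by linarith [norm_nonneg p], mem_disk_iff.1 hp⟩

theorem cosh_hypDist_zero {p : EuclideanSpace ℝ (Fin n)} (hp : p ∈ disk n) :
    cosh (hypDist 0 p) = (1 + ‖p‖ ^ 2) / (1 - ‖p‖ ^ 2) := by
  rw [hypDist_zero_eq hp, cosh_two_mul_artanh (norm_mem_Ioo hp)]

theorem sinh_hypDist_zero {p : EuclideanSpace ℝ (Fin n)} (hp : p ∈ disk n) :
    sinh (hypDist 0 p) = 2 * ‖p‖ / (1 - ‖p‖ ^ 2) := by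
  rw [hypDist_zero_eq hp, sinh_two_mul_artanh (norm_mem_Ioo hp)]

/-! ### Geodesics, the exponential map and the law of cosines. -/

/-- Turns the geodesic equation into a coordinate-free vector equation, so that later computations
involve only inner products. -/
theorem sum_christoffel_mul_mul (p w : EuclideanSpace ℝ (Fin n)) (k : Fin n) :
    ∑ i, ∑ j, christoffel i j k p * w i * w j
      = 2 / (1 - ‖p‖ ^ 2) * (2 * inner ℝ p w * w k - ‖w‖ ^ 2 * p k) := by
  have h1 : inner ℝ p w = ∑ i, p i * w i := by
    simp [PiLp.inner_apply, mul_comm]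
  have h2 : ‖w‖ ^ 2 = ∑ i, w i * w i := by
    rw [EuclideanSpace.real_norm_sq_eq]
    exact Finset.sum_congr rfl fun i _ => sq _
  rw [h1, h2]
  have e : ∀ i j, christoffel i j k p * w i * w j = 2 / (1 - ‖p‖ ^ 2) *
      ((if i = k then w i * (p j * w j) else 0) + (if j = k then w j * (p i * w i) else 0)
        - (if i = j then p k * (w i * w j) else 0)) := fun i j => by
    rw [christoffel]
    split_ifs <;> ring
  simp only [e, ← Finset.mul_sum, Finset.sum_add_distrib, Finset.sum_sub_distrib]
  congr 1
  simp only [Finset.sum_ite_eq, Finset.sum_ite_irrel, Finset.sum_const_zero, Finset.sum_ite_eq',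
    Finset.mem_univ, if_true, ← Finset.mul_sum]
  ring

theorem IsGeodesic.deriv_deriv_eq {γ : ℝ → EuclideanSpace ℝ (Fin n)} (hγ : IsGeodesic γ) (t : ℝ) :
    deriv (deriv γ) t = (2 / (1 - ‖γ t‖ ^ 2)) •
      (‖deriv γ t‖ ^ 2 • γ t - (2 * inner ℝ (γ t) (deriv γ t)) • deriv γ t) := by
  ext k
  have h := hγ.equation t k
  rw [sum_christoffel_mul_mul] at h
  simp only [PiLp.smul_apply, PiLp.sub_apply, smul_eq_mul]
  linear_combination h

theorem IsGeodesic.hasDerivAt {γ : ℝ → EuclideanSpace ℝ (Fin n)} (hγ : IsGeodesic γ) (t : ℝ) :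
    HasDerivAt γ (deriv γ t) t :=
  (hγ.contDiff.differentiable two_ne_zero t).hasDerivAt

theorem IsGeodesic.hasDerivAt_deriv {γ : ℝ → EuclideanSpace ℝ (Fin n)} (hγ : IsGeodesic γ)
    (t : ℝ) : HasDerivAt (deriv γ) (deriv (deriv γ) t) t := by
  have : ContDiff ℝ 1 (deriv γ) := ((contDiff_succ_iff_deriv (n := 1)).1 hγ.contDiff).2.2
  exact (this.differentiable one_ne_zero t).hasDerivAt

/-- The speed of a geodesic is constant. -/
theorem IsGeodesic.speed_eq {γ : ℝ → EuclideanSpace ℝ (Fin n)} (hγ : IsGeodesic γ) (t : ℝ) :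
    4 * ‖deriv γ t‖ ^ 2 / (1 - ‖γ t‖ ^ 2) ^ 2 = metricNorm (γ 0) (deriv γ 0) ^ 2 := by
  have hd : ∀ t, HasDerivAt (fun t => 4 * ‖deriv γ t‖ ^ 2 / (1 - ‖γ t‖ ^ 2) ^ 2) 0 t := fun t => by
    have hpos := one_sub_normSq_pos (hγ.mem_disk t)
    refine ((hγ.hasDerivAt_deriv t).norm_sq.const_mul 4).div
      (((hγ.hasDerivAt t).norm_sq.const_sub 1).pow 2) (by simp; positivity) |>.congr_deriv ?_
    rw [hγ.deriv_deriv_eq t]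
    simp only [inner_smul_right, inner_sub_right, real_inner_self_eq_norm_sq,
      real_inner_comm (γ t) (deriv γ t), Pi.pow_apply]
    rw [div_eq_zero_iff]
    left
    field_simp
    push_cast
    ring
  have := is_const_of_deriv_eq_zero (fun t => (hd t).differentiableAt) (fun t => (hd t).deriv) t 0
  rw [this, metricNorm_eq (hγ.mem_disk 0), mul_pow, div_pow]
  ring

/-- A solution of `u'' = b² u`. -/
theorem eq_cosh_add_sinh_of_deriv_deriv {u u₁ : ℝ → ℝ} {b m : ℝ}
    (h₁ : ∀ t, HasDerivAt u (u₁ t) t) (h₂ : ∀ t, HasDerivAt u₁ (b ^ 2 * u t) t)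
    (h0 : u₁ 0 = b * m) (t : ℝ) : u t = cosh (b * t) * u 0 + sinh (b * t) * m := by
  have hd : ∀ s, HasDerivAt (fun s => s * b) b s := fun s => by
    simpa using (hasDerivAt_id s).mul_const b
  -- First integrals from `D² - b² = (D - b)(D + b)`; for `b ≠ 0` the two determine `u`.
  have hW : ∀ s, HasDerivAt (fun s => exp (-(s * b)) * (u₁ s + b * u s)) 0 s := fun s =>
    ((hd s).neg.exp.mul ((h₂ s).add ((h₁ s).const_mul b))).congr_deriv (by simp; ring)
  have hV : ∀ s, HasDerivAt (fun s => exp (s * b) * (u₁ s - b * u s)) 0 s := fun s =>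
    ((hd s).exp.mul ((h₂ s).sub ((h₁ s).const_mul b))).congr_deriv (by simp; ring)
  have hW' := fun t => is_const_of_deriv_eq_zero (fun s => (hW s).differentiableAt)
    (fun s => (hW s).deriv) t 0
  have hV' := fun t => is_const_of_deriv_eq_zero (fun s => (hV s).differentiableAt)
    (fun s => (hV s).deriv) t 0
  -- For `b = 0` both integrals are `u'`, which the initial condition `u'(0) = b m` forces to be
  -- `0`, so `u` is constant.
  rcases eq_or_ne b 0 with rfl | hb
  · have hu : ∀ t, u₁ t = 0 := fun t => by
      have := hW' t
      simpa [h0] using this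
    have := is_const_of_deriv_eq_zero (fun s => (h₁ s).differentiableAt)
      (fun s => by rw [(h₁ s).deriv, hu s]) t 0
    simp [this]
  · have hW := hW' t
    have hV := hV' t
    simp only [zero_mul, neg_zero, exp_zero, one_mul, h0] at hW hV
    have he : exp (t * b) * exp (-(t * b)) = 1 := by rw [← exp_add]; simp
    have : (2 * b) * u t = (2 * b) * (cosh (b * t) * u 0 + sinh (b * t) * m) := by
      rw [cosh_eq, sinh_eq, mul_comm b t]
      linear_combination exp (t * b) * hW - exp (-(t * b)) * hV - (2 * b * u t) * he
    exact mul_left_cancel₀ (by simpa using hb) this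

/-- The hyperbolic cosine of the distance from the origin along a geodesic. -/
theorem IsGeodesic.cosh_hypDist_zero {γ : ℝ → EuclideanSpace ℝ (Fin n)} (hγ : IsGeodesic γ)
    {m : ℝ} (hm : 4 * inner ℝ (γ 0) (deriv γ 0) / (1 - ‖γ 0‖ ^ 2) ^ 2
      = metricNorm (γ 0) (deriv γ 0) * m) :
    cosh (hypDist 0 (γ 1)) = cosh (metricNorm (γ 0) (deriv γ 0)) * cosh (hypDist 0 (γ 0))
      + sinh (metricNorm (γ 0) (deriv γ 0)) * m := by
  have := eq_cosh_add_sinh_of_deriv_deriv (u := fun t => (1 + ‖γ t‖ ^ 2) / (1 - ‖γ t‖ ^ 2))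
    (u₁ := fun t => 4 * inner ℝ (γ t) (deriv γ t) / (1 - ‖γ t‖ ^ 2) ^ 2)
    (b := metricNorm (γ 0) (deriv γ 0)) (m := m) (fun t => ?_) (fun t => ?_) hm 1
  · rw [PoincareBall.cosh_hypDist_zero (hγ.mem_disk 1),
      PoincareBall.cosh_hypDist_zero (hγ.mem_disk 0)]
    simpa using this
  · have hpos := one_sub_normSq_pos (hγ.mem_disk t)
    refine ((hγ.hasDerivAt t).norm_sq.const_add 1).div ((hγ.hasDerivAt t).norm_sq.const_sub 1)
      hpos.ne' |>.congr_deriv ?_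
    congr 1
    ring
  · have hpos := one_sub_normSq_pos (hγ.mem_disk t)
    refine (((hγ.hasDerivAt t).inner ℝ (hγ.hasDerivAt_deriv t)).const_mul 4).div
      (((hγ.hasDerivAt t).norm_sq.const_sub 1).pow 2) (by simp; positivity) |>.congr_deriv ?_
    rw [hγ.deriv_deriv_eq t, ← hγ.speed_eq t]
    simp only [inner_smul_right, inner_sub_right, real_inner_self_eq_norm_sq, Pi.pow_apply]
    field_simp
    push_cast
    ring

/-- Projecting a geodesic `(Y, Z)` of the hyperboloid to the ball gives a geodesic. -/
theorem isGeodesic_of_hyperboloid {Y Y₁ : ℝ → EuclideanSpace ℝ (Fin n)} {Z Z₁ : ℝ → ℝ} {b : ℝ}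
    (hY : ∀ t, HasDerivAt Y (Y₁ t) t) (hY₁ : ∀ t, HasDerivAt Y₁ (b ^ 2 • Y t) t)
    (hZ : ∀ t, HasDerivAt Z (Z₁ t) t) (hZ₁ : ∀ t, HasDerivAt Z₁ (b ^ 2 * Z t) t)
    (hYc : ContDiff ℝ 2 Y) (hZc : ContDiff ℝ 2 Z) (hpos : ∀ t, 0 < Z t)
    (hYY : ∀ t, ‖Y t‖ ^ 2 = Z t ^ 2 - 1) (hYY₁ : ∀ t, inner ℝ (Y t) (Y₁ t) = Z t * Z₁ t)
    (hY₁Y₁ : ∀ t, ‖Y₁ t‖ ^ 2 = Z₁ t ^ 2 + b ^ 2) :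
    IsGeodesic (fun t => (1 + Z t)⁻¹ • Y t) ∧ ∀ t, deriv (fun t => (1 + Z t)⁻¹ • Y t) t
      = (1 + Z t)⁻¹ • Y₁ t - (Z₁ t / (1 + Z t) ^ 2) • Y t := by
  have h1 : ∀ t, 0 < 1 + Z t := fun t => by linarith [hpos t]
  have hd : ∀ t, HasDerivAt (fun t => (1 + Z t)⁻¹ • Y t)
      ((1 + Z t)⁻¹ • Y₁ t - (Z₁ t / (1 + Z t) ^ 2) • Y t) t := fun t => by
    refine ((((hZ t).const_add 1).inv (h1 t).ne').smul (hY t)).congr_deriv ?_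
    rw [neg_div, neg_smul, sub_eq_add_neg]
    rfl
  have hderiv : deriv (fun t => (1 + Z t)⁻¹ • Y t)
      = fun t => (1 + Z t)⁻¹ • Y₁ t - (Z₁ t / (1 + Z t) ^ 2) • Y t := funext fun t => (hd t).deriv
  -- Uses `|Y|² = Z² - 1 = (Z - 1)(Z + 1)`.
  have hn : ∀ t, ‖(1 + Z t)⁻¹ • Y t‖ ^ 2 = (Z t - 1) / (1 + Z t) := fun t => by
    have := h1 t
    rw [norm_smul, mul_pow, hYY t, norm_of_nonneg (by positivity)]
    field_simp
    ring
  refine ⟨⟨(((contDiff_const.add hZc).inv fun t => (h1 t).ne').smul hYc), fun t => ?_,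
    fun t k => ?_⟩, fun t => by rw [hderiv]⟩
  · rw [mem_disk_iff]
    have : ‖(1 + Z t)⁻¹ • Y t‖ ^ 2 < 1 := by
      rw [hn, div_lt_one (h1 t)]; linarith
    nlinarith [norm_nonneg ((1 + Z t)⁻¹ • Y t)]
  · have hdd : HasDerivAt (fun t => (1 + Z t)⁻¹ • Y₁ t - (Z₁ t / (1 + Z t) ^ 2) • Y t)
        ((1 + Z t)⁻¹ • (b ^ 2 • Y t) - (2 * Z₁ t / (1 + Z t) ^ 2) • Y₁ t
          - ((b ^ 2 * Z t) / (1 + Z t) ^ 2 - 2 * Z₁ t ^ 2 / (1 + Z t) ^ 3) • Y t) t := by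
      have := h1 t
      refine (((((hZ t).const_add 1).inv (h1 t).ne').smul (hY₁ t)).sub
        (((hZ₁ t).div (((hZ t).const_add 1).pow 2) (by simp; positivity)).smul
          (hY t))).congr_deriv ?_
      simp only [Pi.inv_apply, Pi.div_apply, Pi.pow_apply]
      ext k
      simp
      field_simp
      ring
    rw [sum_christoffel_mul_mul, hderiv, hdd.deriv, hn]
    have hin : inner ℝ ((1 + Z t)⁻¹ • Y t) ((1 + Z t)⁻¹ • Y₁ t - (Z₁ t / (1 + Z t) ^ 2) • Y t)
        = Z₁ t / (1 + Z t) ^ 2 := by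
      have := h1 t
      simp only [inner_smul_right, inner_sub_right, real_inner_smul_left,
        real_inner_self_eq_norm_sq, hYY, hYY₁]
      field_simp
      ring
    have hnn : ‖(1 + Z t)⁻¹ • Y₁ t - (Z₁ t / (1 + Z t) ^ 2) • Y t‖ ^ 2 = b ^ 2 / (1 + Z t) ^ 2 := by
      have := h1 t
      rw [← real_inner_self_eq_norm_sq]
      simp only [inner_smul_right, inner_sub_right, inner_sub_left, real_inner_smul_left,
        real_inner_self_eq_norm_sq, hYY, hYY₁, hY₁Y₁, real_inner_comm (Y t) (Y₁ t)]
      field_simp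
      ring
    rw [hin, hnn]
    have h1' := (h1 t).ne'
    have h2 : 1 - (Z t - 1) / (1 + Z t) = 2 / (1 + Z t) := by field_simp; ring
    rw [h2]
    simp
    field_simp
    ring

theorem exists_isGeodesic {p : EuclideanSpace ℝ (Fin n)} (hp : p ∈ disk n)
    (v : EuclideanSpace ℝ (Fin n)) :
    ∃ γ : ℝ → EuclideanSpace ℝ (Fin n), IsGeodesic γ ∧ γ 0 = p ∧ deriv γ 0 = v := by
  have hpos := one_sub_normSq_pos hp
  -- The unit tangent vector `(B, β)` below requires division by the speed `b`, so `v = 0` gets the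
  -- constant geodesic.
  rcases eq_or_ne v 0 with rfl | hv
  · refine ⟨fun _ => p, ⟨contDiff_const, fun _ => hp, fun t k => ?_⟩, rfl, by simp⟩
    have : deriv (fun _ : ℝ => p) = fun _ => 0 := by ext; simp
    simp [this]
  set l := 2 / (1 - ‖p‖ ^ 2) with hl
  have hl0 : 0 < l := by positivity
  have hpl : ‖p‖ ^ 2 = 1 - 2 / l := by rw [hl]; field_simp; ring
  set b := l * ‖v‖ with hb
  have hb0 : 0 < b := mul_pos hl0 (norm_pos_iff.2 hv)
  have hvb : ‖v‖ ^ 2 = b ^ 2 / l ^ 2 := by rw [hb]; field_simp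
  set s := inner ℝ p v with hs
  -- the point and the tangent vector on the hyperboloid
  set A : EuclideanSpace ℝ (Fin n) := l • p with hA
  set B : EuclideanSpace ℝ (Fin n) := b⁻¹ • (l • v + (l ^ 2 * s) • p) with hB
  set α := l - 1 with hα
  set β := b⁻¹ * (l ^ 2 * s) with hβ
  have hAA : ‖A‖ ^ 2 = α ^ 2 - 1 := by
    rw [hA, norm_smul, mul_pow, hpl, norm_of_nonneg hl0.le, hα]; field_simp; ring
  have hAB : inner ℝ A B = α * β := by
    simp only [hA, hB, hα, hβ, inner_smul_right, inner_add_right, real_inner_smul_left,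
      real_inner_self_eq_norm_sq, hpl, ← hs]
    field_simp
    ring
  have hBB : ‖B‖ ^ 2 = β ^ 2 + 1 := by
    rw [← real_inner_self_eq_norm_sq]
    simp only [hB, hβ, inner_smul_right, inner_add_right, real_inner_smul_left, inner_add_left,
      real_inner_self_eq_norm_sq, hpl, real_inner_comm p v, ← hs, hvb]
    field_simp
    ring
  have hα1 : 1 ≤ α := by
    have : 2 ≤ l := by
      rw [hl, le_div_iff₀ hpos]; nlinarith [sq_nonneg ‖p‖]
    linarith
  -- Cauchy–Schwarz for `A` and `B` reads `α²β² ≤ (α² - 1)(β² + 1)`, that is, `β² ≤ α² - 1`.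
  have hβα : |β| < α := by
    refine abs_lt_of_sq_lt_sq ?_ (by linarith)
    have h1 := real_inner_mul_inner_self_le A B
    rw [hAB, real_inner_self_eq_norm_sq, real_inner_self_eq_norm_sq, hAA, hBB] at h1
    nlinarith
  have hdt : ∀ t, HasDerivAt (fun t => b * t) b t := fun t => by
    simpa using (hasDerivAt_id t).const_mul b
  have hch : ∀ t, cosh (b * t) ^ 2 = sinh (b * t) ^ 2 + 1 := fun t => cosh_sq _
  -- The curve stays on the upper sheet: `|sinh| < cosh` and `|β| < α`.
  have hZpos : ∀ t, 0 < cosh (b * t) * α + sinh (b * t) * β := by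
    intro t
    have h1 : |sinh (b * t)| < cosh (b * t) := by
      rw [abs_lt]; constructor <;>
        linarith [exp_pos (b * t), exp_pos (-(b * t)), cosh_eq (b * t), sinh_eq (b * t)]
    have h2 : |sinh (b * t) * β| < cosh (b * t) * α := by
      rw [abs_mul]
      exact mul_lt_mul'' h1 hβα (abs_nonneg _) (abs_nonneg _)
    linarith [(abs_lt.1 h2).1]
  have hYY : ∀ t, ‖cosh (b * t) • A + sinh (b * t) • B‖ ^ 2
      = (cosh (b * t) * α + sinh (b * t) * β) ^ 2 - 1 := by
    intro t
    rw [← real_inner_self_eq_norm_sq]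
    simp only [inner_smul_right, inner_add_right, inner_add_left, real_inner_smul_left,
      real_inner_self_eq_norm_sq, hAA, hBB, hAB, real_inner_comm A B]
    linear_combination (-1) * hch t
  have hYY₁ : ∀ t, inner ℝ (cosh (b * t) • A + sinh (b * t) • B)
      ((b * sinh (b * t)) • A + (b * cosh (b * t)) • B)
      = (cosh (b * t) * α + sinh (b * t) * β)
        * ((b * sinh (b * t)) * α + (b * cosh (b * t)) * β) := by
    intro t
    simp only [inner_smul_right, inner_add_right, inner_add_left, real_inner_smul_left,
      real_inner_self_eq_norm_sq, hAA, hBB, hAB, real_inner_comm A B]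
    ring
  have hY₁Y₁ : ∀ t, ‖(b * sinh (b * t)) • A + (b * cosh (b * t)) • B‖ ^ 2
      = ((b * sinh (b * t)) * α + (b * cosh (b * t)) * β) ^ 2 + b ^ 2 := by
    intro t
    rw [← real_inner_self_eq_norm_sq]
    simp only [inner_smul_right, inner_add_right, inner_add_left, real_inner_smul_left,
      real_inner_self_eq_norm_sq, hAA, hBB, hAB, real_inner_comm A B]
    linear_combination b ^ 2 * hch t
  obtain ⟨hg, hg'⟩ := isGeodesic_of_hyperboloid (b := b)
    (Y := fun t => cosh (b * t) • A + sinh (b * t) • B)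
    (Y₁ := fun t => (b * sinh (b * t)) • A + (b * cosh (b * t)) • B)
    (Z := fun t => cosh (b * t) * α + sinh (b * t) * β)
    (Z₁ := fun t => (b * sinh (b * t)) * α + (b * cosh (b * t)) * β)
    (fun t => (((hdt t).cosh.smul_const A).add ((hdt t).sinh.smul_const B)).congr_deriv
      (by simp only [mul_comm b]))
    (fun t => ((((hdt t).sinh.const_mul b).smul_const A).add
      (((hdt t).cosh.const_mul b).smul_const B)).congr_deriv
        (by simp only [smul_add, smul_smul]; ring_nf))
    (fun t => (((hdt t).cosh.mul_const α).add ((hdt t).sinh.mul_const β)).congr_deriv (by ring))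
    (fun t => ((((hdt t).sinh.const_mul b).mul_const α).add
      (((hdt t).cosh.const_mul b).mul_const β)).congr_deriv (by ring))
    (by fun_prop) (by fun_prop) hZpos hYY hYY₁ hY₁Y₁
  refine ⟨_, hg, ?_, ?_⟩
  · simp [hA, hα, smul_smul, hl0.ne']
  · rw [hg']
    simp [hA, hB, hα, hβ]
    ext k
    simp
    field_simp
    ring

/-- The hyperbolic law of cosines, for a triangle with a vertex at the origin. -/
theorem cosh_hypDist_zero_expMap {p : EuclideanSpace ℝ (Fin n)} (hp : p ∈ disk n)
    (v : EuclideanSpace ℝ (Fin n)) {y : ℝ} (hy : inner ℝ p v = ‖p‖ * ‖v‖ * y) :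
    expMap p v ∈ disk n ∧
    cosh (hypDist 0 (expMap p v)) = cosh (metricNorm p v) * cosh (hypDist 0 p)
      + sinh (metricNorm p v) * sinh (hypDist 0 p) * y := by
  have h := exists_isGeodesic hp v
  -- The law of cosines holds for every geodesic with these initial data, so uniqueness of geodesics
  -- is not needed for the chosen one.
  obtain ⟨hg, h0, h1⟩ := h.choose_spec
  have he : expMap p v = h.choose 1 := by rw [expMap, dif_pos h]
  have hpos := one_sub_normSq_pos hp
  rw [he]
  refine ⟨hg.mem_disk 1, ?_⟩
  have := hg.cosh_hypDist_zero (m := sinh (hypDist 0 p) * y) ?_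
  · rw [this, h0, h1, mul_assoc]
  · rw [h0, h1, hy, metricNorm_eq hp, sinh_hypDist_zero hp]
    field_simp
    ring

/-! ### Differentiability, gradient and Hessian of the half squared distance. -/

/-- Where `h` vanishes, the product rule needs no derivative of `φ`. This handles the origin, where
`φ` depends on the norm and only its continuity is at hand. -/
theorem hasFDerivAt_smul_of_continuousAt {V F : Type*} [NormedAddCommGroup V] [NormedSpace ℝ V]
    [NormedAddCommGroup F] [NormedSpace ℝ F] {φ : V → ℝ} {h : V → F} {h' : V →L[ℝ] F} {x : V}
    (hφ : ContinuousAt φ x) (hx : h x = 0) (hh : HasFDerivAt h h' x) :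
    HasFDerivAt (fun y => φ y • h y) (φ x • h') x := by
  rw [hasFDerivAt_iff_isLittleO] at hh ⊢
  have h1 : (fun y => (φ y - φ x) • h' (y - x)) =o[nhds x] fun y => y - x := by
    have h2 : (fun y => φ y - φ x) =o[nhds x] fun _ => (1 : ℝ) :=
      (Asymptotics.isLittleO_one_iff ℝ).2 (by simpa using hφ.sub_const (φ x))
    simpa using h2.smul_isBigO (h'.isBigO_comp (fun y => y - x) (nhds x))
  have h3 : (fun y => φ y • (h y - h x - h' (y - x))) =o[nhds x] fun y => y - x := by
    simpa using (hφ.isBigO_one ℝ).smul_isLittleO hh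
  refine (h3.add h1).congr_left fun y => ?_
  simp only [hx, sub_zero, smul_zero, _root_.smul_apply, smul_sub, sub_smul]
  abel

/-- The function `r ↦ artanh r / r`, extended continuously to `0`. -/
def artanhDivSelf : ℝ → ℝ := dslope artanh 0

theorem artanhDivSelf_zero : artanhDivSelf 0 = 1 := by
  rw [artanhDivSelf, dslope_same, (hasDerivAt_artanh (by norm_num)).deriv]
  norm_num

theorem mul_artanhDivSelf (r : ℝ) : r * artanhDivSelf r = artanh r := by
  simpa [artanhDivSelf] using sub_smul_dslope artanh 0 r

theorem hasDerivAt_artanhDivSelf {r : ℝ} (hr : r ∈ Set.Ioo (-1 : ℝ) 1) (h0 : r ≠ 0) :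
    HasDerivAt artanhDivSelf ((1 / (1 - r ^ 2) - artanhDivSelf r) / r) r := by
  have : HasDerivAt (fun r => artanh r / r) ((1 / (1 - r ^ 2) - artanhDivSelf r) / r) r := by
    refine ((hasDerivAt_artanh hr).div (hasDerivAt_id r) h0).congr_deriv ?_
    rw [← mul_artanhDivSelf r]
    simp only [id]
    field_simp
  refine this.congr_of_eventuallyEq ?_
  filter_upwards [isOpen_ne.mem_nhds h0] with s hs
  rw [← mul_artanhDivSelf s, mul_div_cancel_left₀ _ hs]

theorem continuousAt_artanhDivSelf {r : ℝ} (hr : r ∈ Set.Ioo (-1 : ℝ) 1) :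
    ContinuousAt artanhDivSelf r := by
  rcases eq_or_ne r 0 with rfl | h0
  · exact continuousAt_dslope_same.2 (hasDerivAt_artanh hr).differentiableAt
  · exact (hasDerivAt_artanhDivSelf hr h0).continuousAt

/-- With `θ = 2 artanh r`, `coth θ = (1 + r²) / (2r)`. This form shows the continuity at the origin,
hence that the maximum over a compact set exists. -/
theorem mulCoth_hypDist_zero {p : EuclideanSpace ℝ (Fin n)} (hp : p ∈ disk n) :
    mulCoth (hypDist 0 p) = artanhDivSelf ‖p‖ * (1 + ‖p‖ ^ 2) := by
  have hpos := one_sub_normSq_pos hp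
  rcases eq_or_ne p 0 with rfl | h0
  · simp [hypDist_zero_eq hp, mulCoth, artanhDivSelf_zero]
  have h0 := norm_pos_iff.2 h0
  have : 0 < hypDist 0 p := by
    rw [hypDist_zero_eq hp]
    exact mul_pos two_pos (artanh_pos ⟨h0, mem_disk_iff.1 hp⟩)
  rw [mulCoth_of_pos this, cosh_hypDist_zero hp, sinh_hypDist_zero hp, hypDist_zero_eq hp,
    ← mul_artanhDivSelf]
  field_simp

theorem continuousOn_mulCoth_hypDist_zero :
    ContinuousOn (fun p => mulCoth (hypDist 0 p)) (disk n) := by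
  have : ContinuousOn (fun p : EuclideanSpace ℝ (Fin n) =>
      artanhDivSelf ‖p‖ * (1 + ‖p‖ ^ 2)) (disk n) := fun p hp => by
    refine ((ContinuousAt.comp (g := artanhDivSelf)
      (continuousAt_artanhDivSelf (norm_mem_Ioo hp)) continuous_norm.continuousAt).mul
      (by fun_prop)).continuousWithinAt
  exact this.congr fun p hp => mulCoth_hypDist_zero hp

/-- The Euclidean gradient of the half squared distance at `p` is `radialFactor ‖p‖ • p`. -/
def radialFactor (r : ℝ) : ℝ := 4 * artanhDivSelf r / (1 - r ^ 2)

theorem halfSqDist_eq {p : EuclideanSpace ℝ (Fin n)} (hp : p ∈ disk n) :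
    halfSqDist n p = 2 * artanh ‖p‖ ^ 2 := by
  rw [halfSqDist, hypDist_zero_eq hp]
  ring

theorem disk_mem_nhds {p : EuclideanSpace ℝ (Fin n)} (hp : p ∈ disk n) : disk n ∈ nhds p :=
  Metric.isOpen_ball.mem_nhds hp

theorem hasFDerivAt_norm_of_ne {p : EuclideanSpace ℝ (Fin n)} (h0 : p ≠ 0) :
    HasFDerivAt (fun q : EuclideanSpace ℝ (Fin n) => ‖q‖) (‖p‖⁻¹ • innerSL ℝ p) p := by
  have h := norm_pos_iff.2 h0
  have h1 := (hasStrictFDerivAt_norm_sq p).hasFDerivAt.sqrt (by positivity)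
  simp only [sqrt_sq (norm_nonneg _)] at h1
  refine h1.congr_fderiv ?_
  ext w
  simp
  field_simp

theorem hasFDerivAt_halfSqDist {p : EuclideanSpace ℝ (Fin n)} (hp : p ∈ disk n) :
    HasFDerivAt (halfSqDist n) (radialFactor ‖p‖ • innerSL ℝ p) p := by
  rcases eq_or_ne p 0 with rfl | h0
  -- Near the origin `f = 2 (artanh r / r)² · r²`: a continuous factor times a differentiable
  -- function vanishing at `0`.
  · have h1 := hasFDerivAt_smul_of_continuousAt
      (φ := fun q : EuclideanSpace ℝ (Fin n) => 2 * artanhDivSelf ‖q‖ ^ 2)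
      (h := fun q => ‖q‖ ^ 2) (x := 0)
      (((ContinuousAt.comp (g := artanhDivSelf) (continuousAt_artanhDivSelf (norm_mem_Ioo hp))
        continuous_norm.continuousAt).pow 2).const_mul 2)
      (by simp) (hasStrictFDerivAt_norm_sq _).hasFDerivAt
    refine (h1.congr_of_eventuallyEq ?_).congr_fderiv (by simp)
    filter_upwards [disk_mem_nhds hp] with q hq
    rw [halfSqDist_eq hq, ← mul_artanhDivSelf, smul_eq_mul]
    ring
  · have h1 := (((hasDerivAt_artanh (norm_mem_Ioo hp)).comp_hasFDerivAt p
      (hasFDerivAt_norm_of_ne h0)).pow 2).const_mul 2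
    refine (h1.congr_of_eventuallyEq ?_).congr_fderiv ?_
    · filter_upwards [disk_mem_nhds hp] with q hq
      rw [halfSqDist_eq hq]
      rfl
    · have h := norm_pos_iff.2 h0
      have hpos := one_sub_normSq_pos hp
      ext w
      simp [radialFactor, ← mul_artanhDivSelf]
      field_simp
      ring

theorem fderiv_halfSqDist {p : EuclideanSpace ℝ (Fin n)} (hp : p ∈ disk n) :
    fderiv ℝ (halfSqDist n) p = radialFactor ‖p‖ • innerSL ℝ p :=
  (hasFDerivAt_halfSqDist hp).fderiv

theorem hasDerivAt_radialFactor {r : ℝ} (hr : r ∈ Set.Ioo (-1 : ℝ) 1) (h0 : r ≠ 0) :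
    HasDerivAt radialFactor
      (4 * (1 - artanhDivSelf r * (1 - 3 * r ^ 2)) / (r * (1 - r ^ 2) ^ 2)) r := by
  have hpos : 1 - r ^ 2 ≠ 0 := by nlinarith [hr.1, hr.2]
  refine (((hasDerivAt_artanhDivSelf hr h0).const_mul 4).div
    (((hasDerivAt_id r).pow 2).const_sub 1) hpos).congr_deriv ?_
  simp
  field_simp
  ring

theorem continuousAt_radialFactor {r : ℝ} (hr : r ∈ Set.Ioo (-1 : ℝ) 1) :
    ContinuousAt radialFactor r := by
  have hpos : 1 - r ^ 2 ≠ 0 := by nlinarith [hr.1, hr.2]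
  exact ((continuousAt_artanhDivSelf hr).const_mul 4).div (by fun_prop) hpos

/-- The Euclidean inner product as a continuous bilinear map. -/
def innerCLM (n : ℕ) :
    EuclideanSpace ℝ (Fin n) →L[ℝ] EuclideanSpace ℝ (Fin n) →L[ℝ] ℝ := innerSL ℝ

theorem innerCLM_apply (v w : EuclideanSpace ℝ (Fin n)) : innerCLM n v w = inner ℝ v w := rfl

/-- Differentiates `radialFactor |q| · q`; away from the origin `s = radialFactor'(r) / r` with `r =
|p|`. Prescribing only `s r²` covers the origin too, where the rank-one term vanishes and `s` is
immaterial. -/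
theorem exists_hasFDerivAt_fderiv_halfSqDist {p : EuclideanSpace ℝ (Fin n)} (hp : p ∈ disk n) :
    ∃ s : ℝ, s * ‖p‖ ^ 2
        = 4 * (1 - artanhDivSelf ‖p‖ * (1 - 3 * ‖p‖ ^ 2)) / (1 - ‖p‖ ^ 2) ^ 2 ∧
      HasFDerivAt (fderiv ℝ (halfSqDist n))
        (radialFactor ‖p‖ • innerCLM n + (s • innerSL ℝ p).smulRight (innerSL ℝ p)) p := by
  have hev : fderiv ℝ (halfSqDist n) =ᶠ[nhds p] fun q => radialFactor ‖q‖ • innerSL ℝ q := by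
    filter_upwards [disk_mem_nhds hp] with q hq using fderiv_halfSqDist hq
  rcases eq_or_ne p 0 with rfl | h0
  · refine ⟨0, by simp [artanhDivSelf_zero], ?_⟩
    have h1 := hasFDerivAt_smul_of_continuousAt
      (φ := fun q : EuclideanSpace ℝ (Fin n) => radialFactor ‖q‖)
      (h := fun q => innerCLM n q) (x := 0)
      (ContinuousAt.comp (g := radialFactor) (continuousAt_radialFactor (norm_mem_Ioo hp))
        continuous_norm.continuousAt)
      (by simp) (innerCLM n).hasFDerivAt
    refine (h1.congr_of_eventuallyEq hev).congr_fderiv ?_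
    ext v w
    change radialFactor ‖(0 : EuclideanSpace ℝ (Fin n))‖ * inner ℝ v w
      = radialFactor ‖(0 : EuclideanSpace ℝ (Fin n))‖ * inner ℝ v w
        + (0 * inner ℝ 0 v) * inner ℝ 0 w
    rw [zero_mul, zero_mul, add_zero]
  · have h := norm_pos_iff.2 h0
    have hpos := one_sub_normSq_pos hp
    refine ⟨4 * (1 - artanhDivSelf ‖p‖ * (1 - 3 * ‖p‖ ^ 2)) / (‖p‖ * (1 - ‖p‖ ^ 2) ^ 2) * ‖p‖⁻¹,
      by field_simp, ?_⟩
    have h1 := ((hasDerivAt_radialFactor (norm_mem_Ioo hp) h.ne').comp_hasFDerivAt p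
      (hasFDerivAt_norm_of_ne h0)).smul
      (innerCLM n).hasFDerivAt
    refine (h1.congr_of_eventuallyEq hev).congr_fderiv ?_
    rw [smul_smul]
    rfl

theorem partialDeriv_halfSqDist {p : EuclideanSpace ℝ (Fin n)} (hp : p ∈ disk n) (i : Fin n) :
    partialDeriv (halfSqDist n) i p = radialFactor ‖p‖ * p i := by
  rw [partialDeriv, fderiv_halfSqDist hp]
  simp [EuclideanSpace.inner_single_right]

theorem metricMatrix_inv {p : EuclideanSpace ℝ (Fin n)} (hp : p ∈ disk n) :
    (metricMatrix p)⁻¹ = ((1 - ‖p‖ ^ 2) / 2) ^ 2 • (1 : Matrix (Fin n) (Fin n) ℝ) := by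
  have hpos := one_sub_normSq_pos hp
  refine Matrix.inv_eq_right_inv ?_
  rw [metricMatrix, Matrix.smul_mul, Matrix.mul_smul, smul_smul, one_mul, ← mul_pow,
    div_mul_div_cancel₀ hpos.ne']
  simp

theorem metricInner_grad_halfSqDist {p : EuclideanSpace ℝ (Fin n)} (hp : p ∈ disk n)
    (v : EuclideanSpace ℝ (Fin n)) :
    metricInner p v (grad (halfSqDist n) p) = radialFactor ‖p‖ * inner ℝ p v := by
  have hpos := one_sub_normSq_pos hp
  have : grad (halfSqDist n) p = (((1 - ‖p‖ ^ 2) / 2) ^ 2 * radialFactor ‖p‖) • p := by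
    ext i
    rw [grad, metricMatrix_inv hp]
    simp [partialDeriv_halfSqDist hp, Matrix.smul_mulVec, mul_assoc]
  rw [metricInner_eq, this, inner_smul_right, real_inner_comm]
  field_simp

/-- The rank-one term acts only along `p`, so directions orthogonal to `p` have eigenvalue `θ coth
θ`; the scalar identity says that the radial eigenvalue is `1`. At `p = 0` it reduces to `mulCoth 0
= 1`. -/
theorem hessianOperator_halfSqDist {p : EuclideanSpace ℝ (Fin n)} (hp : p ∈ disk n) :
    ∃ b : ℝ, mulCoth (hypDist 0 p) + b * ‖p‖ ^ 2 = 1 ∧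
      hessianOperator (halfSqDist n) p
        = mulCoth (hypDist 0 p) • (1 : Matrix (Fin n) (Fin n) ℝ)
          + Matrix.vecMulVec (b • p.ofLp) p.ofLp := by
  obtain ⟨s, hs, hd⟩ := exists_hasFDerivAt_fderiv_halfSqDist hp
  have hpos := one_sub_normSq_pos hp
  have hpp : ∀ i j, partialDeriv (partialDeriv (halfSqDist n) j) i p
      = radialFactor ‖p‖ * (if i = j then 1 else 0) + s * p i * p j := fun i j => by
    have := (hd.clm_apply (hasFDerivAt_const (EuclideanSpace.single j (1 : ℝ)) p)).fderiv
    rw [partialDeriv]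
    change fderiv ℝ (fun q => fderiv ℝ (halfSqDist n) q (EuclideanSpace.single j 1)) p _ = _
    rw [this]
    simp [innerCLM_apply, EuclideanSpace.inner_single_right, eq_comm]
  have hG : ∀ i j, ∑ k, christoffel i j k p * partialDeriv (halfSqDist n) k p
      = 2 / (1 - ‖p‖ ^ 2) * radialFactor ‖p‖ *
        (2 * p i * p j - (if i = j then ‖p‖ ^ 2 else 0)) := fun i j => by
    have e : ∀ k, christoffel i j k p * partialDeriv (halfSqDist n) k p
        = 2 / (1 - ‖p‖ ^ 2) * radialFactor ‖p‖ * ((if i = k then p j * p k else 0)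
          + (if j = k then p i * p k else 0) - (if i = j then p k ^ 2 else 0)) := fun k => by
      rw [christoffel, partialDeriv_halfSqDist hp]
      split_ifs <;> ring
    simp only [e, ← Finset.mul_sum, Finset.sum_add_distrib, Finset.sum_sub_distrib]
    simp only [Finset.sum_ite_eq, Finset.sum_ite_irrel, Finset.sum_const_zero,
      Finset.mem_univ, if_true, ← EuclideanSpace.real_norm_sq_eq]
    ring
  refine ⟨((1 - ‖p‖ ^ 2) / 2) ^ 2 * (s - 4 / (1 - ‖p‖ ^ 2) * radialFactor ‖p‖), ?_, ?_⟩
  · rw [mulCoth_hypDist_zero hp, mul_assoc, sub_mul, hs, radialFactor]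
    field_simp
    ring
  · ext i j
    rw [hessianOperator, metricMatrix_inv hp, Matrix.smul_mul, one_mul, Matrix.smul_apply, hessian,
      Matrix.of_apply, hpp, hG, mulCoth_hypDist_zero hp]
    simp only [Matrix.add_apply, Matrix.smul_apply, Matrix.one_apply, Matrix.vecMulVec_apply,
      Pi.smul_apply, smul_eq_mul, radialFactor]
    split_ifs
    · field_simp
      ring
    · field_simp
      ring

/-- Shift of the variable in the characteristic polynomial of a rank-one matrix. -/
theorem charpoly_smul_one_add_vecMulVec {a : ℝ} {u v : Fin n → ℝ} (hn : 1 ≤ n) :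
    (a • (1 : Matrix (Fin n) (Fin n) ℝ) + Matrix.vecMulVec u v).charpoly
      = (Polynomial.X - Polynomial.C (a + u ⬝ᵥ v)) * (Polynomial.X - Polynomial.C a) ^ (n - 1) := by
  have h := Matrix.charpoly_sub_scalar (Matrix.vecMulVec u v) (-a)
  have e : Matrix.vecMulVec u v - Matrix.scalar (Fin n) (-a)
      = a • (1 : Matrix (Fin n) (Fin n) ℝ) + Matrix.vecMulVec u v := by
    rw [Matrix.scalar_apply, ← Matrix.smul_one_eq_diagonal, neg_smul, sub_neg_eq_add, add_comm]
  rw [e, Matrix.charpoly_vecMulVec, Fintype.card_fin] at h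
  obtain ⟨m, rfl⟩ : ∃ m, n = m + 1 := ⟨n - 1, by omega⟩
  rw [h]
  simp [Polynomial.smul_eq_C_mul]
  ring

/-! ### The two-sided bound and the main theorem. -/

theorem halfSqDist_expMap_bounds {p : EuclideanSpace ℝ (Fin n)} (hp : p ∈ disk n)
    (v : EuclideanSpace ℝ (Fin n)) :
    1 / 2 * metricNorm p v ^ 2 ≤ halfSqDist n (expMap p v) - halfSqDist n p
        - metricInner p v (grad (halfSqDist n) p) ∧
      halfSqDist n (expMap p v) - halfSqDist n p - metricInner p v (grad (halfSqDist n) p)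
        ≤ mulCoth (hypDist 0 p) / 2 * metricNorm p v ^ 2 := by
  have hpos := one_sub_normSq_pos hp
  have habs := abs_real_inner_div_norm_mul_norm_le_one p v
  set y := inner ℝ p v / (‖p‖ * ‖v‖) with hy
  -- If `p = 0` or `v = 0`, division by zero makes `y = 0`, which is harmless: both sides vanish.
  have hyp : inner ℝ p v = ‖p‖ * ‖v‖ * y := by
    rcases eq_or_ne p 0 with rfl | hp0
    · simp
    rcases eq_or_ne v 0 with rfl | hv0
    · simp
    have := norm_ne_zero_iff.2 hp0
    have := norm_ne_zero_iff.2 hv0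
    rw [hy]
    field_simp
  obtain ⟨hq, hcosh⟩ := cosh_hypDist_zero_expMap hp v hyp
  obtain ⟨h1, h2⟩ := law_of_cosines_comparison (hypDist_zero_nonneg hq) (sqrt_nonneg _)
    (hypDist_zero_nonneg hp) habs hcosh
  have hin : metricInner p v (grad (halfSqDist n) p) = metricNorm p v * hypDist 0 p * y := by
    rw [metricInner_grad_halfSqDist hp, metricNorm_eq hp, hypDist_zero_eq hp, hyp, radialFactor,
      ← mul_artanhDivSelf]
    field_simp
    ring
  rw [hin, halfSqDist, halfSqDist]
  change metricNorm p v ^ 2 + hypDist 0 p ^ 2 + 2 * metricNorm p v * hypDist 0 p * y ≤ _ at h1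
  change _ ≤ mulCoth (hypDist 0 p) * metricNorm p v ^ 2 + hypDist 0 p ^ 2
    + 2 * metricNorm p v * hypDist 0 p * y at h2
  constructor <;> linarith

end PoincareBall

end

theorem mainTheorem2 (n : ℕ) (hn : 1 ≤ n) (K : Set (EuclideanSpace ℝ (Fin n)))
    (hK : IsCompact K) (hKD : K ⊆ PoincareBall.disk n) (h0 : 0 ∈ K) :
    PoincareBall.GeodesicallyStronglyConvexOn 1 (PoincareBall.halfSqDist n)
      (PoincareBall.disk n) ∧
    (∃ L : ℝ,
      IsGreatest ((fun p => PoincareBall.mulCoth (PoincareBall.hypDist 0 p)) '' K) L ∧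
      PoincareBall.GeodesicallySmoothOn L (PoincareBall.halfSqDist n) K) ∧
    (∀ p ∈ PoincareBall.disk n,
      DifferentiableAt ℝ (fderiv ℝ (PoincareBall.halfSqDist n)) p ∧
      (PoincareBall.hessianOperator (PoincareBall.halfSqDist n) p).charpoly =
        (Polynomial.X - Polynomial.C 1) *
          (Polynomial.X - Polynomial.C (PoincareBall.mulCoth (PoincareBall.hypDist 0 p)))
            ^ (n - 1)) := by
  open PoincareBall in
  refine ⟨fun p hp => ⟨(hasFDerivAt_halfSqDist hp).differentiableAt, fun v =>
    (halfSqDist_expMap_bounds hp v).1⟩, ?_, fun p hp => ⟨?_, ?_⟩⟩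
  · obtain ⟨L, hL⟩ := (hK.image_of_continuousOn
      (continuousOn_mulCoth_hypDist_zero.mono hKD)).exists_isGreatest ⟨_, Set.mem_image_of_mem _ h0⟩
    refine ⟨L, hL, fun p hp => ⟨(hasFDerivAt_halfSqDist (hKD hp)).differentiableAt, fun v => ?_⟩⟩
    obtain ⟨h1, h2⟩ := halfSqDist_expMap_bounds (hKD hp) v
    have h3 := hL.2 (Set.mem_image_of_mem _ hp)
    -- The strong convexity bound makes the quantity nonnegative, so only the upper bound matters
    -- for smoothness.
    rw [abs_of_nonneg ((by positivity : (0 : ℝ) ≤ _).trans h1)]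
    exact h2.trans (by gcongr)
  · obtain ⟨s, -, hs⟩ := exists_hasFDerivAt_fderiv_halfSqDist hp
    exact hs.differentiableAt
  · obtain ⟨b, hb, h⟩ := hessianOperator_halfSqDist hp
    have hpp : (b • p.ofLp) ⬝ᵥ p.ofLp = b * ‖p‖ ^ 2 := by
      rw [smul_dotProduct, EuclideanSpace.real_norm_sq_eq, smul_eq_mul]
      simp [dotProduct, sq]
    rw [h, charpoly_smul_one_add_vecMulVec hn, hpp, hb]
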